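/- For $n\ge 1$ let $X_n$ denote the number of blocks in a set partition chosen uniformly at random among all partitions of $\{1,2,\dots,n\}$ into non-empty blocks. For $x>0$ let $W(x)$ denote the principal branch of the Lambert $W$-function, i.e. the unique positive solution $w$ of $we^w=x$, and put \[ \mu_n:=\frac{n}{W(n)},\qquad \sigma_n^2:=\frac{n}{W(n)\,(W(n)+1)}. \] Then, as $n\to\infty$, the mean and the variance of $X_n$ satisfy \[ \mathbb{E}(X_n)=\mu_n+O(W(n)),\qquad \mathbb{V}(X_n)=\sigma_n^2+O\bigl(W(n)^2\bigr). \] -/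

import Mathlib

open MeasureTheory ProbabilityTheory Filter Asymptotics

namespace StirlingPartition

/-- Partitions of an `n`-element set into non-empty, pairwise disjoint blocks. -/
abbrev SetPartition (n : ℕ) : Type := Finpartition (Finset.univ : Finset (Fin n))

/-- Every set of partitions is an event. -/
instance instMeasurableSpaceSetPartition (n : ℕ) : MeasurableSpace (SetPartition n) := ⊤

/-- The uniform distribution on all partitions of an `n`-element set. -/
noncomputable def uniformPartition (n : ℕ) : Measure (SetPartition n) :=
  (PMF.uniformOfFintype (SetPartition n)).toMeasure

/-- The random variable `X_n`: the number of blocks of a partition, as a real number. -/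
def numBlocks (n : ℕ) (P : SetPartition n) : ℝ := (P.parts.card : ℝ)

/-- The mean `E(X_n)`. -/
noncomputable def meanBlocks (n : ℕ) : ℝ := ∫ P, numBlocks n P ∂(uniformPartition n)

/-- The variance `V(X_n)`. -/
noncomputable def varBlocks (n : ℕ) : ℝ := variance (numBlocks n) (uniformPartition n)

/-- The (real) principal branch of the Lambert `W`-function: the inverse of `w ↦ w * exp w`
on `[-1, ∞)`. Its values at `x < -1/e` are irrelevant. -/
noncomputable def lambertW (x : ℝ) : ℝ :=
  Function.invFunOn (fun w : ℝ => w * Real.exp w) (Set.Ici (-1)) x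

theorem strictMonoOn_mul_exp :
    StrictMonoOn (fun w : ℝ => w * Real.exp w) (Set.Ici (-1)) := by
  apply strictMonoOn_of_deriv_pos (convex_Ici _) (by fun_prop)
  intro w hw
  rw [interior_Ici, Set.mem_Ioi] at hw
  have h : HasDerivAt (fun w : ℝ => w * Real.exp w) (1 * Real.exp w + w * Real.exp w) w :=
    (hasDerivAt_id w).mul (Real.hasDerivAt_exp w)
  rw [h.deriv]
  nlinarith [Real.exp_pos w]

/-- For `x > 0`, `lambertW x` is positive and solves `w * exp w = x`. -/
theorem lambertW_spec {x : ℝ} (hx : 0 < x) :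
    0 < lambertW x ∧ lambertW x * Real.exp (lambertW x) = x := by
  have hex : ∃ w ∈ Set.Ici (-1 : ℝ), (fun w : ℝ => w * Real.exp w) w = x := by
    have hc : ContinuousOn (fun w : ℝ => w * Real.exp w) (Set.Icc 0 x) := by fun_prop
    have hm : x ∈ Set.Icc ((fun w : ℝ => w * Real.exp w) 0)
        ((fun w : ℝ => w * Real.exp w) x) := by
      refine ⟨by simpa using hx.le, ?_⟩
      have := Real.one_le_exp hx.le
      change x ≤ x * Real.exp x
      nlinarith
    obtain ⟨w, hw, h⟩ := intermediate_value_Icc hx.le hc hm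
    exact ⟨w, by simpa using (by linarith [hw.1] : (-1 : ℝ) ≤ w), h⟩
  have h : lambertW x * Real.exp (lambertW x) = x := Function.invFunOn_eq hex
  refine ⟨?_, h⟩
  by_contra hn
  nlinarith [Real.exp_pos (lambertW x)]

/-- For `x > 0`, `lambertW x` is the only positive solution of `w * exp w = x`. -/
theorem eq_lambertW {x w : ℝ} (hx : 0 < x) (hw : 0 < w) (h : w * Real.exp w = x) :
    w = lambertW x := by
  obtain ⟨h1, h2⟩ := lambertW_spec hx
  refine strictMonoOn_mul_exp.injOn (by simpa using (by linarith : (-1 : ℝ) ≤ w))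
    (by simpa using (by linarith : (-1 : ℝ) ≤ lambertW x)) ?_
  simp only [h, h2]

/-- `μ_n = n / W(n)`. -/
noncomputable def mu (n : ℕ) : ℝ := n / lambertW n

/-- `σ_n² = n / (W(n) (W(n) + 1))`. -/
noncomputable def sigmaSq (n : ℕ) : ℝ := n / (lambertW n * (lambertW n + 1))

end StirlingPartition

/-! By Dobiński's formula, the law on `k` with weights proportional to `k ^ n / k!` is that of `X_n`
plus an independent Poisson(1) variable. So it suffices to find the mean and variance of this law,
both of which exceed those of `X_n` by one (`meanBlocks_eq`, `varBlocks_eq`).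

Its Stein identity `dobinskiMean_mul` turns `E[k f(k)]` into an average of `f(k + 1) (1 + 1/k) ^ n`.
With `n = W m`, `m = exp W` and `x = k - m`, the factor `(1 + 1/k) ^ n` is close to `m - W/2 - W x +
a x²`, where `a = (W²/2 + W)/m` (`IsSaddle.abs_shiftedWeight_sub_le`). This fails for small `k`,
where the shifted weight itself enters the error bound and the Stein identity converts it back into
an ordinary mean.

Monotonicity of `(1 + 1/k) ^ n` gives a drift towards `m`, hence a sixth central moment `O(m³)`
(`IsSaddle.sixth_moment_le`), which controls all errors. Testing with `1`, `x`, `x²` then gives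
three approximate linear relations between the moments `e_i = E[x ^ i]`: the first yields `e₁ =
O(W)`, the third `e₃ = O(W m)`, and the second then yields `e₂ = m/(W + 1) + O(W²)`. -/

namespace StirlingPartition

/-! ### Dobiński's formula and the moments of the block count. -/

open Finset in
/-- Functions into `Fin k` are counted by their kernel partition. -/
theorem pow_eq_sum_descFactorial (n k : ℕ) :
    k ^ n = ∑ P : SetPartition n, k.descFactorial P.parts.card := by
  classical
  let F : (Σ P : SetPartition n, (P.parts ↪ Fin k)) → (Fin n → Fin k) :=
    fun x i => x.2 ⟨x.1.part i, x.1.part_mem.2 (mem_univ i)⟩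
  have hF : ∀ x i j, F x i = F x j ↔ x.1.part i = x.1.part j := by
    intro x i j
    simp only [F, x.2.injective.eq_iff, Subtype.mk.injEq]
  have hbij : Function.Bijective F := by
    constructor
    · rintro ⟨P, e⟩ ⟨Q, e'⟩ h
      have hpart : ∀ i, P.part i = Q.part i := by
        intro i
        ext j
        rw [P.mem_part_iff_part_eq_part (mem_univ _) (mem_univ _),
          Q.mem_part_iff_part_eq_part (mem_univ _) (mem_univ _),
          ← hF ⟨P, e⟩, ← hF ⟨Q, e'⟩, h]
      have hPQ : P = Q := by
        ext t
        constructor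
        · intro ht
          obtain ⟨i, hi⟩ := P.nonempty_of_mem_parts ht
          rw [← P.part_eq_of_mem ht hi, hpart]
          exact Q.part_mem.2 (mem_univ i)
        · intro ht
          obtain ⟨i, hi⟩ := Q.nonempty_of_mem_parts ht
          rw [← Q.part_eq_of_mem ht hi, ← hpart]
          exact P.part_mem.2 (mem_univ i)
      subst hPQ
      congr 1
      ext ⟨t, ht⟩
      obtain ⟨i, hi⟩ := P.nonempty_of_mem_parts ht
      have := congrFun h i
      simp only [F, P.part_eq_of_mem ht hi] at this
      rw [this]
    · intro f
      let P : SetPartition n := Finpartition.ofSetoid (Setoid.ker f)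
      have hP : ∀ i j, j ∈ P.part i ↔ f i = f j := fun i j =>
        Finpartition.mem_part_ofSetoid_iff_rel
      have hne : ∀ t : P.parts, ∃ i, i ∈ t.1 := fun t => P.nonempty_of_mem_parts t.2
      choose c hc using hne
      refine ⟨⟨P, ⟨fun t => f (c t), ?_⟩⟩, ?_⟩
      · intro t u htu
        have h1 := (hP (c t) (c u)).2 htu
        rw [P.part_eq_of_mem t.2 (hc t)] at h1
        exact Subtype.ext (P.eq_of_mem_parts t.2 u.2 h1 (hc u))
      · funext i
        exact ((hP i _).1 (hc ⟨P.part i, P.part_mem.2 (mem_univ i)⟩)).symm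
  have h := Fintype.card_of_bijective hbij
  simpa [Fintype.card_sigma, Fintype.card_embedding_eq] using h.symm

theorem hasSum_descFactorial_div_factorial (b : ℕ) :
    HasSum (fun k : ℕ => (k.descFactorial b : ℝ) / k.factorial) (Real.exp 1) := by
  have h1 : HasSum (fun k : ℕ => (1 : ℝ) / k.factorial) (Real.exp 1) := by
    have := NormedSpace.exp_series_hasSum_exp' (𝕂 := ℝ) (1 : ℝ)
    simpa [Real.exp_eq_exp_ℝ] using this
  rw [← (add_left_injective b).hasSum_iff (f := fun k : ℕ => (k.descFactorial b : ℝ) / k.factorial)]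
  · convert h1 using 2 with k
    have := Nat.factorial_mul_descFactorial (Nat.le_add_left b k)
    simp only [Function.comp, Nat.add_sub_cancel] at this ⊢
    have h2 : ((k + b).factorial : ℝ) = k.factorial * (k + b).descFactorial b := by
      exact_mod_cast this.symm
    have h3 : ((k + b).factorial : ℝ) ≠ 0 := by positivity
    have h4 : (k.factorial : ℝ) ≠ 0 := by positivity
    rw [div_eq_div_iff h3 h4, h2]
    ring
  · intro k hk
    have : k < b := by
      by_contra hkb
      exact hk ⟨k - b, Nat.sub_add_cancel (not_lt.1 hkb)⟩
    simp [Nat.descFactorial_eq_zero_iff_lt.2 this]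

/-- The weights `k ^ n / k!` of Dobiński's formula. -/
noncomputable def dobinskiWeight (n k : ℕ) : ℝ := (k : ℝ) ^ n / k.factorial

theorem dobinskiWeight_eq_sum (n k : ℕ) :
    dobinskiWeight n k =
      ∑ P : SetPartition n, (k.descFactorial P.parts.card : ℝ) / k.factorial := by
  rw [dobinskiWeight, ← Finset.sum_div]
  congr 1
  exact_mod_cast pow_eq_sum_descFactorial n k

theorem cast_mul_descFactorial (k b : ℕ) :
    (k : ℝ) * k.descFactorial b = k.descFactorial (b + 1) + b * k.descFactorial b := by
  rw [Nat.descFactorial_succ]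
  rcases le_or_gt b k with h | h
  · push_cast [Nat.cast_sub h]
    ring
  · simp [Nat.descFactorial_eq_zero_iff_lt.2 h]

theorem hasSum_dobinskiWeight (n : ℕ) :
    HasSum (dobinskiWeight n) (∑ _P : SetPartition n, Real.exp 1) := by
  have := hasSum_sum (s := (Finset.univ : Finset (SetPartition n)))
    fun P _ => hasSum_descFactorial_div_factorial P.parts.card
  simpa only [← dobinskiWeight_eq_sum] using this

theorem hasSum_mul_dobinskiWeight (n : ℕ) :
    HasSum (fun k : ℕ => (k : ℝ) * dobinskiWeight n k)
      (∑ P : SetPartition n, Real.exp 1 * (numBlocks n P + 1)) := by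
  have := hasSum_sum (s := (Finset.univ : Finset (SetPartition n)))
    fun P _ => (hasSum_descFactorial_div_factorial (P.parts.card + 1)).add
      ((hasSum_descFactorial_div_factorial P.parts.card).mul_left (P.parts.card : ℝ))
  convert this using 2 with k P
  · rw [dobinskiWeight_eq_sum, Finset.mul_sum]
    refine Finset.sum_congr rfl fun P _ => ?_
    rw [← mul_div_assoc, cast_mul_descFactorial]
    ring
  · rw [numBlocks]; ring

theorem hasSum_sq_mul_dobinskiWeight (n : ℕ) :
    HasSum (fun k : ℕ => (k : ℝ) ^ 2 * dobinskiWeight n k)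
      (∑ P : SetPartition n, Real.exp 1 * (numBlocks n P ^ 2 + 2 * numBlocks n P + 2)) := by
  have := hasSum_sum (s := (Finset.univ : Finset (SetPartition n)))
    fun P _ => ((hasSum_descFactorial_div_factorial (P.parts.card + 2)).add
      ((hasSum_descFactorial_div_factorial (P.parts.card + 1)).mul_left
        (2 * P.parts.card + 1 : ℝ))).add
      ((hasSum_descFactorial_div_factorial P.parts.card).mul_left ((P.parts.card : ℝ) ^ 2))
  convert this using 2 with k P
  · rw [dobinskiWeight_eq_sum, Finset.mul_sum]
    refine Finset.sum_congr rfl fun P _ => ?_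
    have h1 := cast_mul_descFactorial k P.parts.card
    have h2 := cast_mul_descFactorial k (P.parts.card + 1)
    push_cast at h2
    -- Applying the recursion for `k * (k)_b` twice; each falling factorial then sums to `e`, and
    -- the coefficients add up to `b² + 2b + 2`.
    have h3 : (k : ℝ) ^ 2 * k.descFactorial P.parts.card =
        k.descFactorial (P.parts.card + 2) +
        (2 * P.parts.card + 1) * k.descFactorial (P.parts.card + 1) +
        (P.parts.card : ℝ) ^ 2 * k.descFactorial P.parts.card := by
      linear_combination (k + P.parts.card : ℝ) * h1 + h2
    rw [← mul_div_assoc, h3]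
    ring
  · rw [numBlocks]; ring

/-- Expectation under the probability weights proportional to `k ^ n / k!`. -/
noncomputable def dobinskiMean (n : ℕ) (f : ℕ → ℝ) : ℝ :=
  (∑' k, f k * dobinskiWeight n k) / ∑' k, dobinskiWeight n k

theorem integral_uniformPartition (n : ℕ) (f : SetPartition n → ℝ) :
    ∫ P, f P ∂(uniformPartition n) = (∑ P, f P) / Fintype.card (SetPartition n) := by
  have : MeasurableSingletonClass (SetPartition n) := ⟨fun _ => trivial⟩
  rw [uniformPartition, PMF.integral_eq_sum]
  simp [PMF.uniformOfFintype_apply, Finset.mul_sum, div_eq_inv_mul]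

theorem card_setPartition_pos (n : ℕ) : (0 : ℝ) < Fintype.card (SetPartition n) := by
  exact_mod_cast Fintype.card_pos

/-- The subtracted 1 is the mean of the independent Poisson(1) summand; in `varBlocks_eq` it is its
variance. -/
theorem meanBlocks_eq (n : ℕ) :
    meanBlocks n = dobinskiMean n (fun k => (k : ℝ)) - 1 := by
  have h := card_setPartition_pos n
  have he := Real.exp_pos 1
  rw [meanBlocks, integral_uniformPartition, dobinskiMean, (hasSum_dobinskiWeight n).tsum_eq,
    (hasSum_mul_dobinskiWeight n).tsum_eq]
  simp only [← Finset.mul_sum, Finset.sum_add_distrib, Finset.sum_const, Finset.card_univ,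
    nsmul_eq_mul]
  field_simp
  ring

theorem varBlocks_eq (n : ℕ) :
    varBlocks n = dobinskiMean n (fun k => (k : ℝ) ^ 2)
      - dobinskiMean n (fun k => (k : ℝ)) ^ 2 - 1 := by
  have h := card_setPartition_pos n
  have he := Real.exp_pos 1
  have : MeasurableSingletonClass (SetPartition n) := ⟨fun _ => trivial⟩
  have : IsProbabilityMeasure (uniformPartition n) := by
    unfold uniformPartition; infer_instance
  rw [varBlocks, variance_eq_sub (MemLp.of_discrete)]
  have h2 : (uniformPartition n)[numBlocks n ^ 2] =
      (∑ P, numBlocks n P ^ 2) / Fintype.card (SetPartition n) :=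
    integral_uniformPartition n _
  rw [h2, integral_uniformPartition, dobinskiMean, dobinskiMean, (hasSum_dobinskiWeight n).tsum_eq,
    (hasSum_mul_dobinskiWeight n).tsum_eq, (hasSum_sq_mul_dobinskiWeight n).tsum_eq]
  simp only [← Finset.mul_sum, Finset.sum_add_distrib, Finset.sum_const, Finset.card_univ,
    nsmul_eq_mul]
  field_simp
  ring

/-! ### Polynomial growth, and means under the Dobiński weights. -/

/-- Sequences bounded by a polynomial. -/
@[fun_prop]
def HasPolyGrowth (f : ℕ → ℝ) : Prop := ∃ (C : ℝ) (N : ℕ), 0 ≤ C ∧ ∀ k : ℕ, |f k| ≤ C * (k + 1) ^ N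

namespace HasPolyGrowth

variable {f g : ℕ → ℝ}

@[fun_prop]
theorem const (c : ℝ) : HasPolyGrowth fun _ => c := ⟨|c|, 0, abs_nonneg c, fun k => by simp⟩

@[fun_prop]
theorem natCast : HasPolyGrowth fun k => (k : ℝ) :=
  ⟨1, 1, zero_le_one, fun k => by rw [abs_of_nonneg (Nat.cast_nonneg k)]; simp⟩

@[fun_prop]
theorem abs (hf : HasPolyGrowth f) : HasPolyGrowth fun k => |f k| := by
  obtain ⟨C, N, hC, h⟩ := hf
  exact ⟨C, N, hC, fun k => by simpa using h k⟩

@[fun_prop]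
theorem add (hf : HasPolyGrowth f) (hg : HasPolyGrowth g) : HasPolyGrowth fun k => f k + g k := by
  obtain ⟨C, N, hC, h⟩ := hf
  obtain ⟨D, M, hD, h'⟩ := hg
  refine ⟨C + D, N + M, add_nonneg hC hD, fun k => (abs_add_le _ _).trans ?_⟩
  have h1 : (1 : ℝ) ≤ k + 1 := by simp
  have h2 : ((k : ℝ) + 1) ^ N ≤ (k + 1) ^ (N + M) := pow_le_pow_right₀ h1 (by omega)
  have h3 : ((k : ℝ) + 1) ^ M ≤ (k + 1) ^ (N + M) := pow_le_pow_right₀ h1 (by omega)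
  rw [add_mul]
  exact add_le_add ((h k).trans (by gcongr)) ((h' k).trans (by gcongr))

@[fun_prop]
theorem mul (hf : HasPolyGrowth f) (hg : HasPolyGrowth g) : HasPolyGrowth fun k => f k * g k := by
  obtain ⟨C, N, hC, h⟩ := hf
  obtain ⟨D, M, hD, h'⟩ := hg
  refine ⟨C * D, N + M, mul_nonneg hC hD, fun k => ?_⟩
  rw [abs_mul, pow_add, mul_mul_mul_comm]
  exact mul_le_mul (h k) (h' k) (abs_nonneg _) (by positivity)

@[fun_prop]
theorem sub (hf : HasPolyGrowth f) (hg : HasPolyGrowth g) : HasPolyGrowth fun k => f k - g k := by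
  have := hf.add ((const (-1)).mul hg)
  simpa [sub_eq_add_neg] using this

@[fun_prop]
theorem pow (hf : HasPolyGrowth f) (N : ℕ) : HasPolyGrowth fun k => f k ^ N := by
  induction N with
  | zero => simpa using const 1
  | succ N ih => simpa only [pow_succ] using ih.mul hf

theorem succ (hf : HasPolyGrowth f) : HasPolyGrowth fun k => f (k + 1) := by
  obtain ⟨C, N, hC, h⟩ := hf
  refine ⟨C * 2 ^ N, N, by positivity, fun k => (h (k + 1)).trans ?_⟩
  rw [mul_assoc, ← mul_pow]
  push_cast
  gcongr
  linarith [(Nat.cast_nonneg k : (0 : ℝ) ≤ k)]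

/-- A factor `k ^ N` only changes the weight of index `n` into that of index `n + N`, which is
summable as well. -/
theorem summable (hf : HasPolyGrowth f) (n : ℕ) : Summable fun k => f k * dobinskiWeight n k := by
  obtain ⟨C, N, hC, h⟩ := hf
  have h1 : Summable fun k => C * 2 ^ N * (dobinskiWeight n k + dobinskiWeight (n + N) k) :=
    ((hasSum_dobinskiWeight n).summable.add (hasSum_dobinskiWeight (n + N)).summable).mul_left _
  refine Summable.of_norm_bounded h1 fun k => ?_
  have hw : 0 ≤ dobinskiWeight n k := by unfold dobinskiWeight; positivity
  have h2 : dobinskiWeight (n + N) k = (k : ℝ) ^ N * dobinskiWeight n k := by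
    unfold dobinskiWeight; ring
  have h3 : ((k : ℝ) + 1) ^ N ≤ 2 ^ N * (1 + k ^ N) := by
    rcases Nat.eq_zero_or_pos k with rfl | hk
    · have : (1 : ℝ) ≤ 2 ^ N := one_le_pow₀ one_le_two
      have h0 : (0 : ℝ) ≤ 0 ^ N := by positivity
      simp only [Nat.cast_zero, zero_add, one_pow]
      nlinarith
    · have hk' : (1 : ℝ) ≤ k := by exact_mod_cast hk
      calc ((k : ℝ) + 1) ^ N ≤ (2 * k) ^ N := by gcongr; linarith
        _ = 2 ^ N * k ^ N := mul_pow _ _ _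
        _ ≤ _ := by gcongr; linarith
  rw [Real.norm_eq_abs, abs_mul, abs_of_nonneg hw, h2]
  calc |f k| * dobinskiWeight n k ≤ (C * (2 ^ N * (1 + k ^ N))) * dobinskiWeight n k := by
        gcongr
        exact (h k).trans (by gcongr)
    _ = _ := by ring

end HasPolyGrowth

theorem dobinskiWeight_nonneg (n k : ℕ) : 0 ≤ dobinskiWeight n k := by
  unfold dobinskiWeight; positivity

theorem tsum_dobinskiWeight_pos (n : ℕ) : 0 < ∑' k, dobinskiWeight n k :=
  (hasSum_dobinskiWeight n).summable.tsum_pos (dobinskiWeight_nonneg n) 1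
    (by simp [dobinskiWeight])

section Mean

variable {n : ℕ} {f g : ℕ → ℝ}

theorem dobinskiMean_const (c : ℝ) : dobinskiMean n (fun _ => c) = c := by
  rw [dobinskiMean, tsum_mul_left, mul_div_cancel_right₀ _ (tsum_dobinskiWeight_pos n).ne']

theorem dobinskiMean_add (hf : HasPolyGrowth f) (hg : HasPolyGrowth g) :
    dobinskiMean n (fun k => f k + g k) = dobinskiMean n f + dobinskiMean n g := by
  simp only [dobinskiMean, ← add_div, ← (hf.summable n).tsum_add (hg.summable n), add_mul]

theorem dobinskiMean_const_mul (c : ℝ) :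
    dobinskiMean n (fun k => c * f k) = c * dobinskiMean n f := by
  simp only [dobinskiMean, mul_assoc, tsum_mul_left, mul_div_assoc]

theorem dobinskiMean_sub (hf : HasPolyGrowth f) (hg : HasPolyGrowth g) :
    dobinskiMean n (fun k => f k - g k) = dobinskiMean n f - dobinskiMean n g := by
  simp only [dobinskiMean, ← sub_div, ← (hf.summable n).tsum_sub (hg.summable n), sub_mul]

theorem dobinskiMean_mono (hf : HasPolyGrowth f) (hg : HasPolyGrowth g) (h : ∀ k, f k ≤ g k) :
    dobinskiMean n f ≤ dobinskiMean n g :=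
  div_le_div_of_nonneg_right ((hf.summable n).tsum_le_tsum
    (fun k => mul_le_mul_of_nonneg_right (h k) (dobinskiWeight_nonneg n k)) (hg.summable n))
    (tsum_dobinskiWeight_pos n).le

theorem abs_dobinskiMean_le (hf : HasPolyGrowth f) :
    |dobinskiMean n f| ≤ dobinskiMean n (fun k => |f k|) := by
  rw [abs_le]
  constructor
  · have := dobinskiMean_mono (n := n) (f := fun k => -1 * |f k|) (g := f) (by fun_prop) hf
      fun k => by linarith [neg_abs_le (f k)]
    rw [dobinskiMean_const_mul] at this
    linarith
  · exact dobinskiMean_mono hf hf.abs fun k => le_abs_self _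

/-! ### The Stein identity, exact and approximate. -/

/-- The shifted weights `(k + 1) ^ n / k!`. -/
noncomputable def shiftedWeight (n k : ℕ) : ℝ := ((k : ℝ) + 1) ^ n / k.factorial

theorem shiftedWeight_nonneg (n k : ℕ) : 0 ≤ shiftedWeight n k := by
  unfold shiftedWeight; positivity

theorem succ_mul_dobinskiWeight_succ (n k : ℕ) :
    ((k : ℝ) + 1) * dobinskiWeight n (k + 1) = shiftedWeight n k := by
  rw [dobinskiWeight, shiftedWeight, Nat.factorial_succ]
  push_cast
  field_simp

theorem HasPolyGrowth.summable_shiftedWeight (hf : HasPolyGrowth f) (n : ℕ) :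
    Summable fun k => f (k + 1) * shiftedWeight n k := by
  have h1 : HasPolyGrowth fun k => (k : ℝ) * f k := by fun_prop
  have h2 := (summable_nat_add_iff 1).2 (h1.summable n)
  refine h2.congr fun k => ?_
  rw [← succ_mul_dobinskiWeight_succ]
  push_cast
  ring

/-- The Stein identity of the Dobiński weights. -/
theorem dobinskiMean_mul (hf : HasPolyGrowth f) :
    dobinskiMean n (fun k => (k : ℝ) * f k) =
      (∑' k, f (k + 1) * shiftedWeight n k) / ∑' k, dobinskiWeight n k := by
  have h1 : HasPolyGrowth fun k => (k : ℝ) * f k := by fun_prop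
  rw [dobinskiMean, (h1.summable n).tsum_eq_zero_add]
  congr 1
  simp only [Nat.cast_zero, zero_mul, zero_add]
  refine tsum_congr fun k => ?_
  rw [← succ_mul_dobinskiWeight_succ]
  push_cast
  ring

/-- Replacing the shifted weights by a polynomial multiple of the weights in the Stein identity. -/
theorem abs_dobinskiMean_mul_sub_le {p ρ τ : ℕ → ℝ} (hf : HasPolyGrowth f) (hp : HasPolyGrowth p)
    (hρ : HasPolyGrowth ρ) (hτ : HasPolyGrowth τ)
    (h : ∀ k, |shiftedWeight n k - p k * dobinskiWeight n k| ≤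
      ρ k * dobinskiWeight n k + τ (k + 1) * shiftedWeight n k) :
    |dobinskiMean n (fun k => (k : ℝ) * f k) - dobinskiMean n (fun k => f (k + 1) * p k)| ≤
      dobinskiMean n (fun k => |f (k + 1)| * ρ k) +
      dobinskiMean n (fun k => (k : ℝ) * (|f k| * τ k)) := by
  have hf1 := hf.succ
  have hft : HasPolyGrowth fun k => |f k| * τ k := by fun_prop
  rw [dobinskiMean_mul hf, dobinskiMean_mul hft, dobinskiMean, dobinskiMean, ← sub_div, ← add_div,
    abs_div, abs_of_pos (tsum_dobinskiWeight_pos n)]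
  have s1 := hf.summable_shiftedWeight n
  have s2 : Summable fun k => f (k + 1) * p k * dobinskiWeight n k := (hf1.mul hp).summable n
  have s3 : Summable fun k => |f (k + 1)| * ρ k * dobinskiWeight n k :=
    (hf1.abs.mul hρ).summable n
  have s4 := hft.summable_shiftedWeight n
  rw [← s1.tsum_sub s2, ← s3.tsum_add s4]
  refine div_le_div_of_nonneg_right ?_ (tsum_dobinskiWeight_pos n).le
  rw [← Real.norm_eq_abs]
  refine tsum_of_norm_bounded (s3.add s4).hasSum fun k => ?_
  rw [Real.norm_eq_abs, mul_assoc, ← mul_sub, abs_mul]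
  calc _ ≤ |f (k + 1)| * (ρ k * dobinskiWeight n k + τ (k + 1) * shiftedWeight n k) := by
        gcongr
        exact h k
    _ = _ := by ring

/-- Comparison of the two sides of the Stein identity. -/
theorem dobinskiMean_add_le {g ψ : ℕ → ℝ} (hf : HasPolyGrowth f) (hg : HasPolyGrowth g)
    (hψ : HasPolyGrowth ψ)
    (h : ∀ k, ψ k * dobinskiWeight n k + f (k + 1) * shiftedWeight n k ≤
      g k * dobinskiWeight n k) :
    dobinskiMean n ψ + dobinskiMean n (fun k => (k : ℝ) * f k) ≤ dobinskiMean n g := by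
  rw [dobinskiMean_mul hf, dobinskiMean, dobinskiMean, ← add_div,
    ← (hψ.summable n).tsum_add (hf.summable_shiftedWeight n)]
  exact div_le_div_of_nonneg_right (((hψ.summable n).add (hf.summable_shiftedWeight n)).tsum_le_tsum
    h (hg.summable n)) (tsum_dobinskiWeight_pos n).le

end Mean

/-! ### Expansion of `(1 + 1/k) ^ n` around the saddle point. -/

/-- Used with `t = x/m`, `ε = 1/m` and `u = n log(1 + 1/k) - W`. Since `u = -W t` up to `O(W (t² +
ε))`, the second-order Taylor polynomial of `exp` suffices. -/
theorem abs_exp_sub_taylor_le {W t ε u : ℝ} (hW : 4 ≤ W) (ht : 2 * W * |t| ≤ 1) (hε : 0 < ε)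
    (hWε : 40 * (W * ε) ≤ 1)
    (hu : |u - (-(W * t) + W * t ^ 2 - W * ε / 2)| ≤ W * (2 * |t| ^ 3 + 2 * |t| * ε + 5 * ε ^ 2)) :
    |Real.exp u - (1 - W * ε / 2 - W * t + (W ^ 2 / 2 + W) * t ^ 2)| ≤
      50 * (W ^ 2 * (|t| * ε + ε ^ 2) + W ^ 3 * |t| ^ 3) := by
  have ha := abs_nonneg t
  set a := |t| with ha_def
  have hta : t ^ 2 = a ^ 2 := (sq_abs t).symm
  have ha8 : 8 * a ≤ 1 := by nlinarith
  have hε8 : 160 * ε ≤ 1 := by nlinarith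
  have hr : W * (2 * a ^ 3 + 2 * a * ε + 5 * ε ^ 2) ≤ W * (a ^ 2 + ε) := by
    have : 2 * a ^ 3 + 2 * a * ε + 5 * ε ^ 2 ≤ a ^ 2 + ε := by
      have h1 : 2 * a ^ 3 ≤ a ^ 2 := by nlinarith [sq_nonneg a]
      nlinarith
    gcongr
  set r := u - (-(W * t) + W * t ^ 2 - W * ε / 2) with hr_def
  have hur : u = -(W * t) + W * t ^ 2 - W * ε / 2 + r := by rw [hr_def]; ring
  have hWt : |W * t| = W * a := by rw [abs_mul, abs_of_nonneg (by linarith)]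
  have h1 : |u + W * t| ≤ 2 * (W * (a ^ 2 + ε)) := by
    have : u + W * t = W * a ^ 2 - W * ε / 2 + r := by rw [hur, hta]; ring
    rw [this]
    have h2 := abs_le.1 (hu.trans hr)
    have h3 : 0 < W * ε := by positivity
    have h4 : 0 ≤ W * a ^ 2 := by positivity
    rw [abs_le]
    constructor <;> nlinarith
  have h1' : 2 * (W * (a ^ 2 + ε)) ≤ W * a / 4 + 2 * (W * ε) := by
    have : a ^ 2 ≤ a / 8 := by nlinarith
    nlinarith
  have hu1 : |u| ≤ 2 * (W * (a + ε)) := by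
    have h2 : |u| ≤ |u + W * t| + |W * t| := by
      have := abs_sub (u + W * t) (W * t)
      simpa using this
    nlinarith [mul_nonneg (by linarith : (0 : ℝ) ≤ W) ha]
  have hu2 : |u| ≤ 1 := by
    have h2 : |u| ≤ |u + W * t| + |W * t| := by
      have := abs_sub (u + W * t) (W * t)
      simpa using this
    nlinarith [mul_nonneg (by linarith : (0 : ℝ) ≤ W) ha]
  have h3 : |u - W * t| ≤ 3 * (W * (a + ε)) := by
    have h2 : |u - W * t| ≤ |u| + |W * t| := abs_sub _ _
    nlinarith [mul_nonneg (by linarith : (0 : ℝ) ≤ W) hε.le]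
  have hexp : |Real.exp u - (1 + u + u ^ 2 / 2)| ≤ |u| ^ 3 := by
    have := Real.exp_bound hu2 (n := 3) (by norm_num)
    simp only [Finset.sum_range_succ, Finset.sum_range_zero] at this
    norm_num [Nat.factorial] at this
    refine this.trans ?_
    have : 0 ≤ |u| ^ 3 := by positivity
    linarith
  have hcube : |u| ^ 3 ≤ 32 * (W ^ 3 * a ^ 3 + W ^ 2 * ε ^ 2) := by
    have h5 : |u| ^ 3 ≤ (2 * (W * (a + ε))) ^ 3 := by gcongr
    have h6 : (a + ε) ^ 3 ≤ 4 * (a ^ 3 + ε ^ 3) := by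
      nlinarith [mul_nonneg (add_nonneg ha hε.le) (sq_nonneg (a - ε))]
    have h7 : W ^ 3 * ε ^ 3 ≤ W ^ 2 * ε ^ 2 := by
      have : W ^ 3 * ε ^ 3 = (W ^ 2 * ε ^ 2) * (W * ε) := by ring
      rw [this]
      exact mul_le_of_le_one_right (by positivity) (by linarith [mul_pos (by linarith : 0 < W) hε])
    calc |u| ^ 3 ≤ 8 * (W ^ 3 * (a + ε) ^ 3) := by linarith [h5]
      _ ≤ 8 * (W ^ 3 * (4 * (a ^ 3 + ε ^ 3))) := by gcongr
      _ = 32 * (W ^ 3 * a ^ 3 + W ^ 3 * ε ^ 3) := by ring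
      _ ≤ _ := by linarith
  have hsq : |(u + W * t) * (u - W * t)| ≤ 6 * W ^ 2 * (a ^ 3 + 2 * (a * ε) + ε ^ 2) := by
    rw [abs_mul]
    calc _ ≤ (2 * (W * (a ^ 2 + ε))) * (3 * (W * (a + ε))) := by gcongr
      _ = 6 * W ^ 2 * (a ^ 3 + a * ε * a + a * ε + ε ^ 2) := by ring
      _ ≤ _ := by
        refine mul_le_mul_of_nonneg_left ?_ (by positivity)
        nlinarith [mul_nonneg ha hε.le]
  have hW23 : W ^ 2 * a ^ 3 ≤ W ^ 3 * a ^ 3 := by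
    gcongr
    · linarith
    · norm_num
  have hWW2 : W ≤ W ^ 2 := by nlinarith
  have hr' : W * (2 * a ^ 3 + 2 * a * ε + 5 * ε ^ 2) ≤
      W ^ 2 * (2 * a ^ 3 + 2 * a * ε + 5 * ε ^ 2) := by gcongr
  -- Three errors: the Taylor remainder, the error `r` in `u`, and the cost `(u² - W² t²)/2` of
  -- replacing `u²` by `W² t²`.
  have hdec : Real.exp u - (1 - W * ε / 2 - W * t + (W ^ 2 / 2 + W) * t ^ 2) =
      (Real.exp u - (1 + u + u ^ 2 / 2)) + r + (u + W * t) * (u - W * t) / 2 := by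
    rw [hr_def]; ring
  rw [hdec]
  have n1 : 0 ≤ W ^ 2 * (a * ε) := by positivity
  have n2 : 0 ≤ W ^ 2 * ε ^ 2 := by positivity
  have n3 : 0 ≤ W ^ 3 * a ^ 3 := by positivity
  have e1 := abs_le.1 (hexp.trans hcube)
  have e2 := abs_le.1 (hu.trans hr')
  have e3 := abs_le.1 hsq
  rw [abs_le]
  constructor <;> linarith

/-- With `z = 1/(1 + t)` and `ε = 1/m`, the logarithm gives `z - z² ε/2 + O(ε²)`; then `z` is
replaced by `1 - t + t²` and `z²` by 1. -/
theorem abs_mul_log_sub_le {m t : ℝ} (hm : 160 ≤ m) (ht : 8 * |t| ≤ 1) :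
    |m * Real.log (1 + 1 / (m * (1 + t))) - 1 - (-t + t ^ 2 - 1 / m / 2)| ≤
      2 * |t| ^ 3 + 2 * |t| * (1 / m) + 5 * (1 / m) ^ 2 := by
  have ht' := abs_le.1 (show |t| ≤ 1 / 8 by linarith)
  have h1t : 7 / 8 ≤ 1 + t := by linarith
  have h1t0 : 0 < 1 + t := by linarith
  have hm0 : 0 < m := by linarith
  set y := 1 / (m * (1 + t)) with hy
  have hy0 : 0 < y := by positivity
  have hmy : m * y = 1 / (1 + t) := by rw [hy]; field_simp
  have hinv : 1 / (1 + t) ≤ 8 / 7 := by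
    rw [div_le_div_iff₀ h1t0 (by norm_num)]; linarith
  have hinv0 : 0 < 1 / (1 + t) := by positivity
  have hy2 : y ≤ 1 / 2 := by nlinarith
  have hlog : |Real.log (1 + y) - (y - y ^ 2 / 2)| ≤ 2 * y ^ 3 := by
    have := Real.abs_log_sub_add_sum_range_le (x := -y) (by rw [abs_neg, abs_of_pos hy0]; linarith) 2
    simp only [Finset.sum_range_succ, Finset.sum_range_zero] at this
    rw [abs_neg, abs_of_pos hy0] at this
    norm_num at this
    have h2 : y ^ 3 / (1 - y) ≤ 2 * y ^ 3 := by
      rw [div_le_iff₀ (by linarith)]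
      nlinarith [pow_pos hy0 3]
    refine le_trans (le_of_eq ?_) (this.trans h2)
    congr 1
    ring
  set z := 1 / (1 + t) with hz
  have hyz : y = z * (1 / m) := by rw [hy, hz]; field_simp
  have hz1 : z * (1 + t) = 1 := by rw [hz]; field_simp
  have hε0 : 0 < 1 / m := by positivity
  set ε := 1 / m with hε
  have hmε : m * ε = 1 := by rw [hε]; field_simp
  clear_value z ε y
  have hA : |m * Real.log (1 + y) - (z - z ^ 2 * ε / 2)| ≤ 5 * ε ^ 2 := by
    have : m * Real.log (1 + y) - (z - z ^ 2 * ε / 2) =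
        m * (Real.log (1 + y) - (y - y ^ 2 / 2)) := by
      rw [hyz]
      linear_combination (z - z ^ 2 * ε / 2) * hmε
    rw [this, abs_mul, abs_of_pos hm0]
    calc m * |Real.log (1 + y) - (y - y ^ 2 / 2)| ≤ m * (2 * y ^ 3) := by gcongr
      _ = 2 * z ^ 3 * ε ^ 2 * (m * ε) := by rw [hyz]; ring
      _ = 2 * z ^ 3 * ε ^ 2 := by rw [hmε, mul_one]
      _ ≤ 2 * (8 / 7) ^ 3 * ε ^ 2 := by gcongr
      _ ≤ _ := by nlinarith [sq_nonneg ε]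
  have hB : |z - 1 - (-t + t ^ 2)| ≤ 2 * |t| ^ 3 := by
    have : z - 1 - (-t + t ^ 2) = -(z * t ^ 3) := by
      linear_combination (1 - t + t ^ 2) * hz1
    rw [this, abs_neg, abs_mul, abs_pow, abs_of_pos hinv0]
    gcongr
    linarith
  have hC : |z ^ 2 - 1| ≤ 4 * |t| := by
    have : z ^ 2 - 1 = -(t * (z * (1 + z))) := by
      linear_combination (z + 1) * hz1
    rw [this, abs_neg, abs_mul, abs_of_pos (by positivity : 0 < z * (1 + z)), mul_comm]
    gcongr
    nlinarith
  have hC' : |(z ^ 2 - 1) * ε| ≤ 4 * |t| * ε := by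
    rw [abs_mul, abs_of_pos hε0]
    gcongr
  have a1 := abs_le.1 hA
  have a2 := abs_le.1 hB
  have a3 := abs_le.1 hC'
  rw [abs_le]
  constructor <;> linarith

/-- `W` is a large number with `n = W * exp W`, and `m = exp W`. -/
structure IsSaddle (n : ℕ) (W m : ℝ) : Prop where
  large : 40 ≤ W
  exp_eq : Real.exp W = m
  mul_eq : (n : ℝ) = W * m

theorem shiftedWeight_eq (n : ℕ) {k : ℕ} (hk : 1 ≤ k) :
    shiftedWeight n k = Real.exp (n * Real.log (1 + 1 / k)) * dobinskiWeight n k := by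
  have hk0 : (0 : ℝ) < k := by exact_mod_cast hk
  rw [Real.exp_nat_mul, Real.exp_log (by positivity), shiftedWeight, dobinskiWeight,
    ← mul_div_assoc, ← mul_pow]
  congr 2
  field_simp

namespace IsSaddle

variable {n : ℕ} {W m : ℝ}

theorem sq_le (h : IsSaddle n W m) : W ^ 2 ≤ m := by
  have hW := h.large
  have h1 := Real.pow_div_factorial_le_exp W (by linarith) 3
  rw [h.exp_eq] at h1
  norm_num [Nat.factorial] at h1
  nlinarith [sq_nonneg W]

theorem mul_le (h : IsSaddle n W m) : 40 * W ≤ m := by nlinarith [h.sq_le, h.large]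

theorem pos (h : IsSaddle n W m) : 0 < m := by linarith [h.mul_le, h.large]

theorem ne_zero (h : IsSaddle n W m) : n ≠ 0 := by
  rintro rfl
  have h1 : 0 < W * m := mul_pos (by linarith [h.large]) h.pos
  have := h.mul_eq
  simp only [Nat.cast_zero] at this
  linarith

theorem dobinskiWeight_zero (h : IsSaddle n W m) : dobinskiWeight n 0 = 0 := by
  simp [dobinskiWeight, h.ne_zero]

/-- With `le_exp_of_le`, a one-sided bound on each side of `m`: this is all the sixth-moment
estimate needs, as the odd power `(k - m) ^ 5` changes sign there. -/
theorem exp_le_of_le (h : IsSaddle n W m) {x : ℝ} (hx : m ≤ x) :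
    Real.exp (n * Real.log (1 + 1 / x)) ≤ m := by
  have hm := h.pos
  have hx0 : 0 < x := by linarith
  have h1 : Real.log (1 + 1 / x) ≤ 1 / x := by
    have := Real.log_le_sub_one_of_pos (show 0 < 1 + 1 / x by positivity)
    linarith
  conv_rhs => rw [← h.exp_eq]
  rw [Real.exp_le_exp]
  calc (n : ℝ) * Real.log (1 + 1 / x) ≤ n * (1 / m) := by
        gcongr
        exact h1.trans (by gcongr)
    _ = W := by rw [h.mul_eq]; field_simp

theorem le_exp_of_le (h : IsSaddle n W m) {x : ℝ} (hx0 : 0 < x) (hx : x ≤ m) :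
    m - W ≤ Real.exp (n * Real.log (1 + 1 / x)) := by
  have hm := h.pos
  have hW := h.large
  have h1 : 1 / m - (1 / m) ^ 2 ≤ Real.log (1 + 1 / m) := by
    have := Real.one_sub_inv_le_log_of_pos (show 0 < 1 + 1 / m by positivity)
    refine le_trans ?_ this
    have h2 : 1 - (1 + 1 / m)⁻¹ = 1 / (m + 1) := by field_simp; ring
    rw [h2, le_div_iff₀ (by positivity)]
    have : (1 / m - (1 / m) ^ 2) * (m + 1) = 1 - (1 / m) ^ 2 := by field_simp; ring
    rw [this]
    nlinarith [sq_nonneg (1 / m)]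
  have h3 : Real.log (1 + 1 / m) ≤ Real.log (1 + 1 / x) :=
    Real.log_le_log (by positivity) (by gcongr)
  have h4 : W + (-(W / m)) ≤ n * Real.log (1 + 1 / x) := by
    calc W + (-(W / m)) = n * (1 / m - (1 / m) ^ 2) := by rw [h.mul_eq]; field_simp; ring
      _ ≤ _ := by
        gcongr
        exact h1.trans h3
  calc m - W = m * (-(W / m) + 1) := by field_simp; ring
    _ ≤ m * Real.exp (-(W / m)) := by
      gcongr
      exact Real.add_one_le_exp _
    _ = Real.exp (W + (-(W / m))) := by rw [Real.exp_add, h.exp_eq]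
    _ ≤ _ := Real.exp_le_exp.2 h4

/-- Expansion of `(1 + 1 / k) ^ n` in the central region. -/
theorem abs_exp_sub_le_of_central (h : IsSaddle n W m) {x : ℝ} (hx : 2 * W * |x| ≤ m) :
    |Real.exp (n * Real.log (1 + 1 / (m + x))) -
      (m - W / 2 - W * x + (W ^ 2 / 2 + W) / m * x ^ 2)| ≤
      50 * (W ^ 2 * (|x| + 1) / m + W ^ 3 * |x| ^ 3 / m ^ 2) := by
  have hm := h.pos
  have hW := h.large
  have hm40 := h.mul_le
  set t := x / m with ht
  have hxt : x = m * t := by rw [ht]; field_simp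
  clear_value t
  have habs : |x| = m * |t| := by rw [hxt, abs_mul, abs_of_pos hm]
  have ht1 : 2 * W * |t| ≤ 1 := by
    rw [habs] at hx
    by_contra hc
    nlinarith
  have ht8 : 8 * |t| ≤ 1 := by nlinarith [abs_nonneg t]
  have hL := abs_mul_log_sub_le (m := m) (by linarith) ht8
  have hmt : m * (1 + t) = m + x := by rw [hxt]; ring
  rw [hmt] at hL
  have hT := abs_exp_sub_taylor_le (W := W) (t := t) (ε := 1 / m)
    (u := n * Real.log (1 + 1 / (m + x)) - W) (by linarith) ht1 (by positivity)
    (by rw [mul_one_div, ← mul_div_assoc, div_le_one hm]; exact hm40) (by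
      have : n * Real.log (1 + 1 / (m + x)) - W - (-(W * t) + W * t ^ 2 - W * (1 / m) / 2) =
          W * (m * Real.log (1 + 1 / (m + x)) - 1 - (-t + t ^ 2 - 1 / m / 2)) := by
        rw [h.mul_eq]; ring
      rw [this, abs_mul, abs_of_nonneg (by linarith : 0 ≤ W)]
      gcongr)
  have hexp : Real.exp (n * Real.log (1 + 1 / (m + x))) =
      m * Real.exp (n * Real.log (1 + 1 / (m + x)) - W) := by
    rw [Real.exp_sub, h.exp_eq]; field_simp
  rw [hexp]
  have h2 : m * Real.exp (n * Real.log (1 + 1 / (m + x)) - W) -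
      (m - W / 2 - W * x + (W ^ 2 / 2 + W) / m * x ^ 2) =
      m * (Real.exp (n * Real.log (1 + 1 / (m + x)) - W) -
        (1 - W * (1 / m) / 2 - W * t + (W ^ 2 / 2 + W) * t ^ 2)) := by
    rw [mul_sub]
    congr 1
    rw [hxt]
    field_simp
  rw [h2, abs_mul, abs_of_pos hm]
  refine (mul_le_mul_of_nonneg_left hT hm.le).trans (le_of_eq ?_)
  rw [habs]
  field_simp

/-- The quadratic main term is dominated by the cubic error term outside the central region. -/
theorem abs_quadratic_le (h : IsSaddle n W m) {x : ℝ} (hx : m < 2 * W * |x|) :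
    m + |m - W / 2 - W * x + (W ^ 2 / 2 + W) / m * x ^ 2| ≤
      50 * (W ^ 3 * |x| ^ 3 / m ^ 2) := by
  have hm := h.pos
  have hW := h.large
  have hm40 := h.mul_le
  -- In units of `T > 1/2` the claim reduces to `2 + T + T² ≤ 50 T³`.
  set T := W * |x| / m with hT
  have hWx : W * |x| = m * T := by rw [hT]; field_simp
  have hT2 : 1 ≤ 2 * T := by nlinarith
  have hT3 : W ^ 3 * |x| ^ 3 / m ^ 2 = m * T ^ 3 := by rw [hT]; field_simp
  have hq : (W ^ 2 / 2 + W) / m * x ^ 2 ≤ m * T ^ 2 := by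
    have h1 : m * T ^ 2 = W ^ 2 / m * x ^ 2 := by rw [hT, ← sq_abs x]; field_simp
    rw [h1]
    gcongr
    nlinarith
  have hq0 : 0 ≤ (W ^ 2 / 2 + W) / m * x ^ 2 := by positivity
  have hx2 := abs_le.1 (le_refl |W * x|)
  have hWxa : |W * x| = m * T := by rw [abs_mul, abs_of_nonneg (by linarith), hWx]
  rw [hWxa] at hx2
  rw [hT3]
  clear_value T
  have h3 : |m - W / 2 - W * x + (W ^ 2 / 2 + W) / m * x ^ 2| ≤ m * (1 + T + T ^ 2) := by
    have : 0 ≤ m * T ^ 2 := by positivity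
    rw [abs_le]
    constructor <;> linarith
  have h4 : 2 + T + T ^ 2 ≤ 50 * T ^ 3 := by
    nlinarith [mul_nonneg (by linarith : (0 : ℝ) ≤ 2 * T - 1) (sq_nonneg T),
      mul_nonneg (by linarith : (0 : ℝ) ≤ 2 * T - 1) (by linarith : (0 : ℝ) ≤ T)]
  nlinarith

/-- The shifted weights are a quadratic multiple of the weights, up to small errors. -/
theorem abs_shiftedWeight_sub_le (h : IsSaddle n W m) (k : ℕ) :
    |shiftedWeight n k - (m - W / 2 - W * (k - m) + (W ^ 2 / 2 + W) / m * (k - m) ^ 2) *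
      dobinskiWeight n k| ≤
    50 * (W ^ 2 * (|(k : ℝ) - m| + 1) / m + W ^ 3 * |(k : ℝ) - m| ^ 3 / m ^ 2) *
      dobinskiWeight n k +
    64 * (W ^ 3 * |((k + 1 : ℕ) : ℝ) - m| ^ 3 / m ^ 3) * shiftedWeight n k := by
  have hm := h.pos
  have hW := h.large
  have hm40 := h.mul_le
  have hv := shiftedWeight_nonneg n k
  have hw := dobinskiWeight_nonneg n k
  -- Where `|y| ≥ m/(4W)` the last error term alone exceeds the shifted weight; `64 = 4³`.
  have hτ : ∀ y : ℝ, m ≤ 4 * W * |y| → 1 ≤ 64 * (W ^ 3 * |y| ^ 3 / m ^ 3) := by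
    intro y hy
    have h1 : m ^ 3 ≤ (4 * W * |y|) ^ 3 := by gcongr
    rw [← mul_div_assoc, le_div_iff₀ (by positivity)]
    linarith
  set x : ℝ := k - m with hx
  have hx1 : ((k + 1 : ℕ) : ℝ) - m = x + 1 := by push_cast; rw [hx]; ring
  rw [hx1]
  -- That error term is evaluated at `k + 1`; relaxing `2W` to `4W` absorbs the unit shift.
  have hshift : x ≤ 0 → m < 2 * W * |x| → m ≤ 4 * W * |x + 1| := by
    intro h0 h1
    rw [abs_of_nonpos h0] at h1
    have := neg_abs_le (x + 1)
    nlinarith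
  -- At `k = 0` the weight vanishes but the shifted weight is 1, so only the last error term can pay
  -- for it.
  rcases Nat.eq_zero_or_pos k with rfl | hk
  · rw [h.dobinskiWeight_zero]
    have hxm : x = -m := by rw [hx]; simp
    have h1 := hτ (x + 1) (hshift (by linarith) (by
      rw [hxm, abs_neg, abs_of_pos hm]; nlinarith))
    simp only [mul_zero, sub_zero, zero_add, abs_of_nonneg hv]
    exact le_mul_of_one_le_left hv h1
  · have hkx : (k : ℝ) = m + x := by rw [hx]; ring
    have hk0 : (0 : ℝ) < k := by exact_mod_cast hk
    have hv' := shiftedWeight_eq n hk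
    rw [hkx] at hv'
    have hτ0 : 0 ≤ 64 * (W ^ 3 * |x + 1| ^ 3 / m ^ 3) * shiftedWeight n k := by positivity
    have hρ0 : 0 ≤ W ^ 2 * (|x| + 1) / m := by positivity
    set p := m - W / 2 - W * x + (W ^ 2 / 2 + W) / m * x ^ 2 with hp
    rcases le_or_gt (2 * W * |x|) m with hc | hc
    · have h1 := h.abs_exp_sub_le_of_central hc
      rw [hv', ← sub_mul, abs_mul, abs_of_nonneg hw]
      rw [hv'] at hτ0
      nlinarith [mul_le_mul_of_nonneg_right h1 hw]
    · have hQ := h.abs_quadratic_le hc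
      rw [← hp] at hQ
      have hp0 := abs_nonneg p
      have h2 : |shiftedWeight n k - p * dobinskiWeight n k| ≤
          shiftedWeight n k + |p| * dobinskiWeight n k := by
        refine (abs_sub _ _).trans ?_
        rw [abs_mul, abs_of_nonneg hv, abs_of_nonneg hw]
      refine h2.trans ?_
      -- In the left tail `(1 + 1/k) ^ n` may be huge, so the shifted weight is charged to itself;
      -- in the right tail it is at most `m` times the weight.
      rcases le_total x 0 with h0 | h0
      · have h1 := hτ (x + 1) (hshift h0 hc)
        have h3 : |p| * dobinskiWeight n k ≤
            50 * (W ^ 2 * (|x| + 1) / m + W ^ 3 * |x| ^ 3 / m ^ 2) * dobinskiWeight n k := by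
          gcongr
          linarith
        linarith [le_mul_of_one_le_left hv h1]
      · have h1 : shiftedWeight n k ≤ m * dobinskiWeight n k := by
          rw [hv']
          gcongr
          exact h.exp_le_of_le (by linarith)
        have h3 : (m + |p|) * dobinskiWeight n k ≤
            50 * (W ^ 2 * (|x| + 1) / m + W ^ 3 * |x| ^ 3 / m ^ 2) * dobinskiWeight n k := by
          gcongr
          linarith
        linarith

end IsSaddle

/-! ### A priori bound on the sixth central moment. -/

/-- Beyond `y = 300 s` the sixth power dominates the left side; below, every term is `O(s ^ 6)`. -/
theorem half_pow_six_le {W s y : ℝ} (hW : 0 ≤ W) (hWs : W ≤ s) (hs : 1 ≤ s) (hy : 0 ≤ y) :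
    W * y ^ 5 + 30 * (s ^ 2 + y) * (y ^ 4 + 1) ≤ y ^ 6 / 2 + 10 ^ 15 * s ^ 6 := by
  have hs0 : 0 < s := by linarith
  rcases le_or_gt y (300 * s) with h | h
  · have h1 : W * y ^ 5 ≤ s * (300 * s) ^ 5 := by gcongr
    have h2 : 30 * (s ^ 2 + y) * (y ^ 4 + 1) ≤
        30 * (s ^ 2 + 300 * s ^ 2) * ((300 * s) ^ 4 + s ^ 4) := by
      gcongr
      · nlinarith
      · exact one_le_pow₀ hs
    have h3 : 0 ≤ y ^ 6 := by positivity
    have h4 : 0 ≤ s ^ 6 := by positivity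
    nlinarith
  · have h1 : W * y ^ 5 ≤ y / 300 * y ^ 5 := by gcongr; linarith
    have h2 : 30 * (s ^ 2 + y) * (y ^ 4 + 1) ≤ 30 * (y ^ 2 / 150) * (y ^ 4 + y ^ 4) := by
      have : 1 ≤ y ^ 4 := one_le_pow₀ (by linarith)
      gcongr
      nlinarith
    have h3 : 0 ≤ y ^ 6 := by positivity
    have h4 : 0 ≤ s ^ 6 := by positivity
    nlinarith

theorem pow_five_sub_le (x : ℝ) : x ^ 5 - (x - 1) ^ 5 ≤ 30 * (|x| ^ 4 + 1) := by
  have h1 : |x| ^ 4 = x ^ 4 := by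
    rw [show 4 = 2 * 2 by rfl, pow_mul, sq_abs, ← pow_mul]
  rw [h1]
  nlinarith [sq_nonneg (x ^ 2 + x), sq_nonneg (x ^ 2 - 1), sq_nonneg (x + 1), sq_nonneg x]

namespace IsSaddle

variable {n : ℕ} {W m s : ℝ}

theorem le_of_sq_eq (h : IsSaddle n W m) (hs : 0 < s) (hsm : s ^ 2 = m) : W ≤ s :=
  le_of_sq_le_sq (by rw [hsm]; exact h.sq_le) hs.le

/-- A Lyapunov argument: in the Stein identity for a fifth power, the mismatch between `k` and `(1 +
1/k) ^ n` produces `x ^ 6`, and all other terms have lower order on the scale `s`. -/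
theorem sixth_moment_le (h : IsSaddle n W m) (hs : 0 < s) (hsm : s ^ 2 = m) :
    dobinskiMean n (fun k => ((k : ℝ) - m) ^ 6) ≤ 2 * 10 ^ 15 * s ^ 6 := by
  have hm := h.pos
  have hW := h.large
  have hWs := h.le_of_sq_eq hs hsm
  -- The extra `-1` in `f` makes `f (k + 1)` equal to `(k - m) ^ 5`.
  have key := dobinskiMean_add_le (n := n) (f := fun k => ((k : ℝ) - 1 - m) ^ 5)
    (g := fun k => (k : ℝ) * ((k : ℝ) - m) ^ 5)
    (ψ := fun k => ((k : ℝ) - m) ^ 6 - W * |(k : ℝ) - m| ^ 5)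
    (by fun_prop) (by fun_prop) (by fun_prop) (by
      intro k
      have hw := dobinskiWeight_nonneg n k
      push_cast
      rw [add_sub_cancel_right]
      rcases Nat.eq_zero_or_pos k with rfl | hk
      · rw [h.dobinskiWeight_zero]
        have hv := shiftedWeight_nonneg n 0
        have : ((0 : ℕ) - m : ℝ) ^ 5 = -(m ^ 5) := by push_cast; ring
        rw [this]
        nlinarith [pow_pos hm 5]
      · rw [shiftedWeight_eq n hk, ← mul_assoc, ← add_mul]
        refine mul_le_mul_of_nonneg_right ?_ hw
        have hk0 : (0 : ℝ) < k := by exact_mod_cast hk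
        set E := Real.exp (n * Real.log (1 + 1 / k)) with hE
        rcases le_total m k with hmk | hmk
        · have h1 := h.exp_le_of_le hmk
          have hx : (0 : ℝ) ≤ k - m := by linarith
          rw [abs_of_nonneg hx]
          nlinarith [mul_nonneg (pow_nonneg hx 5) (sub_nonneg.2 h1),
            mul_nonneg (by linarith : 0 ≤ W) (pow_nonneg hx 5)]
        · have h1 := h.le_exp_of_le hk0 hmk
          have hx : (0 : ℝ) ≤ m - k := by linarith
          rw [abs_sub_comm, abs_of_nonneg hx]
          have h2 : 0 ≤ (m - k) ^ 5 * (E - (m - W)) :=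
            mul_nonneg (pow_nonneg hx 5) (sub_nonneg.2 h1)
          have h3 : ((k : ℝ) - m) ^ 5 = -(m - k) ^ 5 := by ring
          have h4 : ((k : ℝ) - m) ^ 6 = (m - k) ^ 5 * (m - k) := by ring
          rw [h3, h4]
          linarith)
  -- The unit shift costs `k (x ^ 5 - (x - 1) ^ 5)`, absorbed with `W |x| ^ 5` into half of `x ^ 6`.
  have hbound := dobinskiMean_mono (n := n)
    (f := fun k => (1 / 2 : ℝ) * ((k : ℝ) - m) ^ 6)
    (g := fun k => ((((k : ℝ) - m) ^ 6 - W * |(k : ℝ) - m| ^ 5) + k * ((k : ℝ) - 1 - m) ^ 5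
      - k * ((k : ℝ) - m) ^ 5) + 10 ^ 15 * s ^ 6) (by fun_prop) (by fun_prop) (by
      intro k
      set x : ℝ := k - m with hx
      have hk0 : (0 : ℝ) ≤ k := Nat.cast_nonneg k
      have h1 := half_pow_six_le (by linarith) hWs (by linarith) (abs_nonneg x)
      have h2 := mul_le_mul_of_nonneg_left (pow_five_sub_le x) hk0
      have h3 : (k : ℝ) * (30 * (|x| ^ 4 + 1)) ≤ (s ^ 2 + |x|) * (30 * (|x| ^ 4 + 1)) := by
        gcongr
        rw [hsm]
        linarith [le_abs_self x]
      have h4 : |x| ^ 6 = x ^ 6 := by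
        rw [show 6 = 2 * 3 by rfl, pow_mul, sq_abs, ← pow_mul]
      have h5 : (k : ℝ) - 1 - m = x - 1 := by rw [hx]; ring
      simp only [h5]
      rw [h4] at h1
      linarith)
  rw [dobinskiMean_const_mul, dobinskiMean_add (by fun_prop) (by fun_prop),
    dobinskiMean_sub (by fun_prop) (by fun_prop), dobinskiMean_add (by fun_prop) (by fun_prop),
    dobinskiMean_const] at hbound
  linarith

/-- Functions of sixth-power growth on the scale `s = √m` have bounded mean. -/
theorem dobinskiMean_le (h : IsSaddle n W m) (hs : 0 < s) (hsm : s ^ 2 = m) {f : ℕ → ℝ}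
    (hf : HasPolyGrowth f) {c : ℝ} (hc : 0 ≤ c)
    (hfc : ∀ k : ℕ, f k ≤ c * (1 + |(k : ℝ) - m| / s) ^ 6) :
    dobinskiMean n f ≤ c * 10 ^ 17 := by
  have h1 := dobinskiMean_mono (n := n)
    (g := fun k => 32 * c + 32 * c / s ^ 6 * ((k : ℝ) - m) ^ 6) hf (by fun_prop) fun k => by
      refine (hfc k).trans ?_
      set x : ℝ := k - m
      -- Convexity: `(1 + y) ^ 6 ≤ 32 (1 + y ^ 6)`. The total `32 + 64 * 10 ^ 15` stays below `10 ^
      -- 17`.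
      have h2 := add_pow_le zero_le_one (by positivity : 0 ≤ |x| / s) 6
      have h4 : |x| ^ 6 = x ^ 6 := by
        rw [show 6 = 2 * 3 by rfl, pow_mul, sq_abs, ← pow_mul]
      rw [div_pow, h4] at h2
      norm_num at h2
      calc c * (1 + |x| / s) ^ 6 ≤ c * (32 * (1 + x ^ 6 / s ^ 6)) := by gcongr
        _ = _ := by ring
  rw [dobinskiMean_add (by fun_prop) (by fun_prop), dobinskiMean_const,
    dobinskiMean_const_mul] at h1
  have h3 := h.sixth_moment_le hs hsm
  have h4 : 32 * c / s ^ 6 * dobinskiMean n (fun k => ((k : ℝ) - m) ^ 6) ≤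
      32 * c / s ^ 6 * (2 * 10 ^ 15 * s ^ 6) := by gcongr
  have h5 : 32 * c / s ^ 6 * (2 * 10 ^ 15 * s ^ 6) = 64 * 10 ^ 15 * c := by
    field_simp; ring
  linarith

theorem abs_moment_le (h : IsSaddle n W m) (hs : 0 < s) (hsm : s ^ 2 = m) {i : ℕ} (hi : i ≤ 6) :
    |dobinskiMean n (fun k => ((k : ℝ) - m) ^ i)| ≤ 10 ^ 17 * s ^ i := by
  refine (abs_dobinskiMean_le (by fun_prop)).trans ?_
  rw [mul_comm]
  refine h.dobinskiMean_le hs hsm (by fun_prop) (by positivity) fun k => ?_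
  set x : ℝ := k - m
  have h1 : |x| = s * (|x| / s) := by field_simp
  have h2 : 0 ≤ |x| / s := by positivity
  rw [abs_pow, h1, mul_pow]
  gcongr ?_ * ?_
  · rw [← h1]
    calc (|x| / s) ^ i ≤ (1 + |x| / s) ^ i := by gcongr; linarith
      _ ≤ _ := pow_le_pow_right₀ (by linarith) hi

/-! ### Approximate Stein identities for the test functions `1`, `x`, `x²`. -/

/-- The Stein identity with the shifted weights replaced by their quadratic approximation. -/
theorem abs_stein_sub_le (h : IsSaddle n W m) (hs : 0 < s) (hsm : s ^ 2 = m) {j : ℕ}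
    (hj : j ≤ 2) :
    |dobinskiMean n (fun k => (k : ℝ) * ((k : ℝ) - m) ^ j) -
      dobinskiMean n (fun k => ((k : ℝ) - m + 1) ^ j *
        (m - W / 2 - W * (k - m) + (W ^ 2 / 2 + W) / m * (k - m) ^ 2))| ≤
    114 * 10 ^ 17 * (W ^ 3 * s ^ j / s) := by
  have hm := h.pos
  have hW := h.large
  have hWs := h.le_of_sq_eq hs hsm
  have key := abs_dobinskiMean_mul_sub_le (n := n) (f := fun k => ((k : ℝ) - m) ^ j)
    (p := fun k => m - W / 2 - W * (k - m) + (W ^ 2 / 2 + W) / m * (k - m) ^ 2)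
    (ρ := fun k => 50 * ((W ^ 2 / m) * (|(k : ℝ) - m| + 1) + (W ^ 3 / m ^ 2) * |(k : ℝ) - m| ^ 3))
    (τ := fun k => 64 * ((W ^ 3 / m ^ 3) * |(k : ℝ) - m| ^ 3))
    (by fun_prop) (by fun_prop) (by fun_prop) (by fun_prop)
    (fun k => by
      refine (h.abs_shiftedWeight_sub_le k).trans (le_of_eq ?_)
      ring)
  have hcast : ∀ k : ℕ, ((k + 1 : ℕ) : ℝ) - m = (k : ℝ) - m + 1 := fun k => by push_cast; ring
  simp only [hcast] at key
  refine key.trans ?_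
  have hscale : ∀ x : ℝ, |x| = s * (|x| / s) := fun x => by field_simp
  have b1 := h.dobinskiMean_le hs hsm
    (f := fun k => |((k : ℝ) - m + 1) ^ j| *
      (50 * ((W ^ 2 / m) * (|(k : ℝ) - m| + 1) + (W ^ 3 / m ^ 2) * |(k : ℝ) - m| ^ 3)))
    (by fun_prop) (c := 50 * (W ^ 3 * s ^ j / s)) (by positivity) fun k => by
      set x : ℝ := k - m
      set z := |x| / s with hz
      have hz0 : 0 ≤ z := by positivity
      have hxz : |x| = s * z := hscale x
      have h1 : |x + 1| ≤ s * (1 + z) := by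
        refine (abs_add_le x 1).trans ?_
        rw [abs_one, hxz]
        linarith
      have h2 : (W ^ 2 / m) * (|x| + 1) + (W ^ 3 / m ^ 2) * |x| ^ 3 ≤
          W ^ 3 / s * (1 + z) ^ 3 := by
        have h3 : (W ^ 2 / m) * (|x| + 1) ≤ W ^ 3 / s * (1 + z) := by
          calc (W ^ 2 / m) * (|x| + 1) ≤ (W ^ 2 / m) * (s * (1 + z)) := by
                gcongr
                rw [hxz]
                linarith
            _ = W ^ 2 / s * (1 + z) := by rw [← hsm]; field_simp
            _ ≤ _ := by
              gcongr
              · linarith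
              · norm_num
        have h4 : (W ^ 3 / m ^ 2) * |x| ^ 3 = W ^ 3 / s * z ^ 3 := by
          rw [hxz, ← hsm]; field_simp
        rw [h4]
        have h5 : W ^ 3 / s * ((1 + z) + z ^ 3) ≤ W ^ 3 / s * (1 + z) ^ 3 := by
          gcongr
          nlinarith [sq_nonneg z]
        linarith
      calc |(x + 1) ^ j| * (50 * ((W ^ 2 / m) * (|x| + 1) + (W ^ 3 / m ^ 2) * |x| ^ 3))
          ≤ (s * (1 + z)) ^ j * (50 * (W ^ 3 / s * (1 + z) ^ 3)) := by
            rw [abs_pow]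
            gcongr
        _ = 50 * (W ^ 3 * s ^ j / s) * (1 + z) ^ (j + 3) := by rw [mul_pow, pow_add]; ring
        _ ≤ _ := by
          gcongr
          · linarith
          · omega
  -- The factor `k` raises the degree to `j + 4 ≤ 6`, which is why sixth moments are needed. The
  -- constants 50 and 64 add up to 114.
  have b2 := h.dobinskiMean_le hs hsm
    (f := fun k => (k : ℝ) * (|((k : ℝ) - m) ^ j| * (64 * ((W ^ 3 / m ^ 3) * |(k : ℝ) - m| ^ 3))))
    (by fun_prop) (c := 64 * (W ^ 3 * s ^ j / s)) (by positivity) fun k => by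
      have hkx : (k : ℝ) = m + (k - m) := by ring
      set x : ℝ := k - m
      set z := |x| / s with hz
      have hz0 : 0 ≤ z := by positivity
      have hxz : |x| = s * z := hscale x
      have h1 : (k : ℝ) ≤ s ^ 2 * (1 + z) := by
        have := le_abs_self x
        rw [hxz] at this
        rw [hkx, ← hsm]
        have : s * z ≤ s ^ 2 * z := by
          gcongr
          nlinarith
        linarith
      have hz1 : z ≤ 1 + z := by linarith
      calc (k : ℝ) * (|x ^ j| * (64 * ((W ^ 3 / m ^ 3) * |x| ^ 3)))
          ≤ s ^ 2 * (1 + z) *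
            ((s * (1 + z)) ^ j * (64 * ((W ^ 3 / m ^ 3) * (s * (1 + z)) ^ 3))) := by
            rw [abs_pow, hxz]
            gcongr
        _ = 64 * (W ^ 3 * s ^ j / s) * (1 + z) ^ (j + 4) := by
          rw [← hsm, mul_pow, pow_add]; field_simp
        _ ≤ _ := by
          gcongr
          · linarith
          · omega
  linarith

end IsSaddle

theorem dobinskiMean_quartic (n : ℕ) (m c₀ c₁ c₂ c₃ c₄ : ℝ) :
    dobinskiMean n (fun k => c₀ + c₁ * ((k : ℝ) - m) ^ 1 + c₂ * ((k : ℝ) - m) ^ 2 +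
      c₃ * ((k : ℝ) - m) ^ 3 + c₄ * ((k : ℝ) - m) ^ 4) =
    c₀ + c₁ * dobinskiMean n (fun k => ((k : ℝ) - m) ^ 1) +
      c₂ * dobinskiMean n (fun k => ((k : ℝ) - m) ^ 2) +
      c₃ * dobinskiMean n (fun k => ((k : ℝ) - m) ^ 3) +
      c₄ * dobinskiMean n (fun k => ((k : ℝ) - m) ^ 4) := by
  rw [dobinskiMean_add (by fun_prop) (by fun_prop), dobinskiMean_add (by fun_prop) (by fun_prop),
    dobinskiMean_add (by fun_prop) (by fun_prop), dobinskiMean_add (by fun_prop) (by fun_prop),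
    dobinskiMean_const, dobinskiMean_const_mul, dobinskiMean_const_mul, dobinskiMean_const_mul,
    dobinskiMean_const_mul]

/-! ### Solving the three relations for the first two moments. -/

namespace IsSaddle

variable {n : ℕ} {W m : ℝ}

/-- Moments `e i` of order `i ≤ 4`, controlled by three approximate Stein identities. -/
theorem abs_first_second_moment_le (h : IsSaddle n W m) {A B s a e₁ e₂ e₃ e₄ : ℝ}
    (hs : 0 < s) (hsm : s ^ 2 = m) (hA : 1 ≤ A) (hB : 1 ≤ B) (ha : a = (W ^ 2 / 2 + W) / m)
    (h₂ : |e₂| ≤ A * s ^ 2) (h₃ : |e₃| ≤ A * s ^ 3) (h₄ : |e₄| ≤ A * s ^ 4)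
    (r₀ : |(1 + W) * e₁ - (-(W / 2) + a * e₂)| ≤ B * (W ^ 3 / s))
    (r₁ : |(1 + W) * e₂ - (m - W / 2 * (e₁ + 1) - W * e₁ + a * (e₃ + e₂))| ≤ B * W ^ 3)
    (r₂ : |(1 + W) * e₃ - (2 * m * e₁ + m - W / 2 * (e₂ + 2 * e₁ + 1) - W * (2 * e₂ + e₁) +
      a * (e₄ + 2 * e₃ + e₂))| ≤ B * (W ^ 3 * s)) :
    |e₁| ≤ (1 + A + B) * W ∧ |e₂ - m / (W + 1)| ≤ 30 * (A + B) * W ^ 2 := by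
  have hm := h.pos
  have hW := h.large
  have hWs := h.le_of_sq_eq hs hsm
  have hs1 : 40 ≤ s := by linarith
  have hW0 : 0 < W := by linarith
  have ha0 : 0 ≤ a := by rw [ha]; positivity
  have ham : a * s ^ 2 ≤ W ^ 2 := by
    have : a * s ^ 2 = W ^ 2 / 2 + W := by rw [ha, hsm]; field_simp
    rw [this]; nlinarith
  have hWW : W ≤ W ^ 2 := by nlinarith
  have hWW3 : W ^ 2 ≤ W ^ 3 := by nlinarith [sq_nonneg W]
  have cancel : ∀ x y : ℝ, |(1 + W) * x| ≤ y * W → |x| ≤ y := by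
    intro x y hxy
    rw [abs_mul, abs_of_pos (by linarith)] at hxy
    by_contra hc
    have h1 : y * W < |x| * W := mul_lt_mul_of_pos_right (not_le.1 hc) hW0
    linarith [abs_nonneg x]
  have hae₂ : |a * e₂| ≤ A * W ^ 2 := by
    rw [abs_mul, abs_of_nonneg ha0]
    calc a * |e₂| ≤ a * (A * s ^ 2) := by gcongr
      _ = A * (a * s ^ 2) := by ring
      _ ≤ _ := by gcongr
  have hq₀ : W ^ 3 / s ≤ W ^ 2 := by
    rw [div_le_iff₀ hs, pow_succ]
    gcongr
  have hd₀ : B * (W ^ 3 / s) ≤ B * W ^ 2 := by gcongr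
  have he₁ : |e₁| ≤ (1 + A + B) * W := by
    apply cancel
    have k1 := abs_le.1 r₀
    have k2 := abs_le.1 hae₂
    have k3 : (1 + A + B) * W * W = W ^ 2 + A * W ^ 2 + B * W ^ 2 := by ring
    rw [k3, abs_le]
    constructor <;> linarith
  refine ⟨he₁, ?_⟩
  set U := W ^ 2 * m with hU
  have u1 : W * m ≤ U := by rw [hU]; gcongr
  have u2 : W ^ 2 ≤ U := le_mul_of_one_le_right (by positivity) (by linarith [h.mul_le])
  have hme₁ : |m * e₁| ≤ (1 + A + B) * (W * m) := by
    rw [abs_mul, abs_of_pos hm]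
    calc m * |e₁| ≤ m * ((1 + A + B) * W) := by gcongr
      _ = _ := by ring
  have hWe₁ : |W * e₁| ≤ (1 + A + B) * W ^ 2 := by
    rw [abs_mul, abs_of_pos hW0]
    calc W * |e₁| ≤ W * ((1 + A + B) * W) := by gcongr
      _ = _ := by ring
  have hWe₂ : |W * e₂| ≤ A * (W * m) := by
    rw [abs_mul, abs_of_pos hW0, ← hsm]
    calc W * |e₂| ≤ W * (A * s ^ 2) := by gcongr
      _ = _ := by ring
  have hae₃ : |a * e₃| ≤ A * U := by
    rw [abs_mul, abs_of_nonneg ha0]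
    calc a * |e₃| ≤ a * (A * s ^ 3) := by gcongr
      _ = A * ((a * s ^ 2) * s) := by ring
      _ ≤ A * (W ^ 2 * s ^ 2) := by
        have : s ≤ s ^ 2 := le_self_pow₀ (by linarith) two_ne_zero
        gcongr
      _ = _ := by rw [hU, hsm]
  have hae₄ : |a * e₄| ≤ A * U := by
    rw [abs_mul, abs_of_nonneg ha0]
    calc a * |e₄| ≤ a * (A * s ^ 4) := by gcongr
      _ = A * ((a * s ^ 2) * s ^ 2) := by ring
      _ ≤ A * (W ^ 2 * s ^ 2) := by gcongr
      _ = _ := by rw [hU, hsm]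
  have hd₂ : B * (W ^ 3 * s) ≤ B * U := by
    gcongr
    calc W ^ 3 * s = W ^ 2 * s * W := by ring
      _ ≤ W ^ 2 * s * s := by gcongr
      _ = U := by rw [hU, ← hsm]; ring
  have hWm40 : 40 * (W * m) ≤ U := by
    calc 40 * (W * m) ≤ W * (W * m) := by gcongr
      _ = U := by rw [hU]; ring
  -- The a priori bound on `e₃` would only give `a e₃ = O(W² s)`, too weak for the second relation;
  -- the third relation improves it to `a e₃ = O(W³)`.
  have he₃ : |e₃| ≤ (6 + 8 * A + 4 * B) * (W * m) := by
    apply cancel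
    have k1 := abs_le.1 r₂
    have k2 := abs_le.1 hme₁
    have k3 := abs_le.1 hWe₁
    have k4 := abs_le.1 hWe₂
    have k5 := abs_le.1 hae₃
    have k6 := abs_le.1 hae₄
    have k7 := abs_le.1 hae₂
    have m1 : (1 + A + B) * (W * m) ≤ (1 + A + B) * U := by gcongr
    have m2 : (1 + A + B) * W ^ 2 ≤ (1 + A + B) * U := by gcongr
    have m3 : A * (40 * (W * m)) ≤ A * U := by gcongr
    have m4 : A * W ^ 2 ≤ A * U := by gcongr
    have m5 : m ≤ W * m := le_mul_of_one_le_left hm.le (by linarith)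
    have m6 : (6 + 8 * A + 4 * B) * (W * m) * W = (6 + 8 * A + 4 * B) * U := by rw [hU]; ring
    have m7 : (1 + A + B) * (40 * (W * m)) ≤ (1 + A + B) * U := by gcongr
    have m8 : (1 + A + B) * (W ^ 2 * 40) ≤ (1 + A + B) * U := by
      refine mul_le_mul_of_nonneg_left ?_ (by linarith)
      rw [hU]
      gcongr
      linarith [h.mul_le]
    rw [m6, abs_le]
    constructor <;> linarith
  have hae₃' : |a * e₃| ≤ (6 + 8 * A + 4 * B) * W ^ 3 := by
    rw [abs_mul, abs_of_nonneg ha0]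
    calc a * |e₃| ≤ a * ((6 + 8 * A + 4 * B) * (W * m)) := by gcongr
      _ = (6 + 8 * A + 4 * B) * W * (a * s ^ 2) := by rw [hsm]; ring
      _ ≤ (6 + 8 * A + 4 * B) * W * W ^ 2 := by gcongr
      _ = _ := by ring
  apply cancel
  have k1 := abs_le.1 r₁
  have k2 := abs_le.1 hWe₁
  have k3 := abs_le.1 hae₃'
  have k4 := abs_le.1 hae₂
  have hexp : (1 + W) * (e₂ - m / (W + 1)) = (1 + W) * e₂ - m := by field_simp; ring
  have m1 : (1 + A + B) * W ^ 2 ≤ (1 + A + B) * W ^ 3 := by gcongr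
  have m2 : A * W ^ 2 ≤ A * W ^ 3 := by gcongr
  have m3 : W ^ 3 ≤ A * W ^ 3 := le_mul_of_one_le_left (by positivity) hA
  have m4 : 30 * (A + B) * W ^ 2 * W = 30 * (A + B) * W ^ 3 := by ring
  have m5 : W ^ 3 ≤ B * W ^ 3 := le_mul_of_one_le_left (by positivity) hB
  rw [hexp, m4, abs_le]
  constructor <;> linarith

theorem abs_moments_le (h : IsSaddle n W m) :
    |dobinskiMean n (fun k => ((k : ℝ) - m) ^ 1)| ≤ 10 ^ 20 * W ∧
      |dobinskiMean n (fun k => ((k : ℝ) - m) ^ 2) - m / (W + 1)| ≤ 10 ^ 21 * W ^ 2 := by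
  have hm := h.pos
  have hW := h.large
  obtain ⟨s, hs, hsm⟩ : ∃ s : ℝ, 0 < s ∧ s ^ 2 = m :=
    ⟨Real.sqrt m, Real.sqrt_pos.2 hm, Real.sq_sqrt hm.le⟩
  have m₂ := h.abs_moment_le hs hsm (i := 2) (by norm_num)
  have m₃ := h.abs_moment_le hs hsm (i := 3) (by norm_num)
  have m₄ := h.abs_moment_le hs hsm (i := 4) (by norm_num)
  have q := fun j hj => h.abs_stein_sub_le hs hsm (j := j) hj
  set a := (W ^ 2 / 2 + W) / m with ha
  have r₀ := q 0 (by norm_num)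
  have r₁ := q 1 (by norm_num)
  have r₂ := q 2 (by norm_num)
  have l₀ : dobinskiMean n (fun k => (k : ℝ) * ((k : ℝ) - m) ^ 0) = _ :=
    (congrArg (dobinskiMean n) (funext fun k => by ring)).trans
      (dobinskiMean_quartic n m m 1 0 0 0)
  have l₁ : dobinskiMean n (fun k => (k : ℝ) * ((k : ℝ) - m) ^ 1) = _ :=
    (congrArg (dobinskiMean n) (funext fun k => by ring)).trans
      (dobinskiMean_quartic n m 0 m 1 0 0)
  have l₂ : dobinskiMean n (fun k => (k : ℝ) * ((k : ℝ) - m) ^ 2) = _ :=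
    (congrArg (dobinskiMean n) (funext fun k => by ring)).trans
      (dobinskiMean_quartic n m 0 0 m 1 0)
  have p₀ : dobinskiMean n (fun k => ((k : ℝ) - m + 1) ^ 0 *
      (m - W / 2 - W * (k - m) + a * (k - m) ^ 2)) = _ :=
    (congrArg (dobinskiMean n) (funext fun k => by ring)).trans
      (dobinskiMean_quartic n m (m - W / 2) (-W) a 0 0)
  have p₁ : dobinskiMean n (fun k => ((k : ℝ) - m + 1) ^ 1 *
      (m - W / 2 - W * (k - m) + a * (k - m) ^ 2)) = _ :=
    (congrArg (dobinskiMean n) (funext fun k => by ring)).trans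
      (dobinskiMean_quartic n m (m - W / 2) (m - W / 2 - W) (a - W) a 0)
  have p₂ : dobinskiMean n (fun k => ((k : ℝ) - m + 1) ^ 2 *
      (m - W / 2 - W * (k - m) + a * (k - m) ^ 2)) = _ :=
    (congrArg (dobinskiMean n) (funext fun k => by ring)).trans
      (dobinskiMean_quartic n m (m - W / 2) (2 * (m - W / 2) - W)
        (m - W / 2 - 2 * W + a) (2 * a - W) a)
  rw [l₀, p₀] at r₀
  rw [l₁, p₁] at r₁
  rw [l₂, p₂] at r₂
  have d₀ : W ^ 3 * s ^ 0 / s = W ^ 3 / s := by rw [pow_zero, mul_one]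
  have d₁ : W ^ 3 * s ^ 1 / s = W ^ 3 := by field_simp
  have d₂ : W ^ 3 * s ^ 2 / s = W ^ 3 * s := by field_simp
  rw [d₀] at r₀
  rw [d₁] at r₁
  rw [d₂] at r₂
  generalize dobinskiMean n (fun k => ((k : ℝ) - m) ^ 1) = e₁ at r₀ r₁ r₂ ⊢
  generalize dobinskiMean n (fun k => ((k : ℝ) - m) ^ 2) = e₂ at r₀ r₁ r₂ m₂ ⊢
  generalize dobinskiMean n (fun k => ((k : ℝ) - m) ^ 3) = e₃ at r₀ r₁ r₂ m₃
  generalize dobinskiMean n (fun k => ((k : ℝ) - m) ^ 4) = e₄ at r₀ r₁ r₂ m₄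
  -- Since `k x ^ j = m x ^ j + x ^ (j + 1)`, the leading term `m e_j` occurs on both sides of each
  -- identity and cancels.
  obtain ⟨b₁, b₂⟩ := h.abs_first_second_moment_le hs hsm (e₁ := e₁) (A := 10 ^ 17) (B := 114 * 10 ^ 17)
    (by norm_num) (by norm_num) ha m₂ m₃ m₄
    ((congrArg abs (by ring)).trans_le r₀) ((congrArg abs (by ring)).trans_le r₁)
    ((congrArg abs (by ring)).trans_le r₂)
  constructor
  · refine b₁.trans ?_
    gcongr
    norm_num
  · refine b₂.trans ?_
    gcongr
    norm_num

end IsSaddle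

/-! ### Return to the block count. -/

theorem dobinskiMean_natCast (n : ℕ) (m : ℝ) :
    dobinskiMean n (fun k => (k : ℝ)) = m + dobinskiMean n (fun k => ((k : ℝ) - m) ^ 1) := by
  have h : dobinskiMean n (fun k => (k : ℝ)) = _ :=
    (congrArg (dobinskiMean n) (funext fun k => by ring)).trans
      (dobinskiMean_quartic n m m 1 0 0 0)
  linarith

theorem dobinskiMean_natCast_sq (n : ℕ) (m : ℝ) :
    dobinskiMean n (fun k => (k : ℝ) ^ 2) =
      m ^ 2 + 2 * m * dobinskiMean n (fun k => ((k : ℝ) - m) ^ 1) +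
        dobinskiMean n (fun k => ((k : ℝ) - m) ^ 2) := by
  have h : dobinskiMean n (fun k => (k : ℝ) ^ 2) = _ :=
    (congrArg (dobinskiMean n) (funext fun k => by ring)).trans
      (dobinskiMean_quartic n m (m ^ 2) (2 * m) 1 0 0)
  linarith

theorem eventually_isSaddle :
    ∀ᶠ n : ℕ in atTop, IsSaddle n (lambertW n) (Real.exp (lambertW n)) := by
  filter_upwards [eventually_ge_atTop (⌈40 * Real.exp 40⌉₊), eventually_gt_atTop 0] with n hn hn0
  have hn0' : (0 : ℝ) < n := by exact_mod_cast hn0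
  have hn' : 40 * Real.exp 40 ≤ n := Nat.ceil_le.1 hn
  obtain ⟨h0, h1⟩ := lambertW_spec hn0'
  refine ⟨?_, rfl, h1.symm⟩
  by_contra hc
  have := Real.exp_lt_exp.2 (not_le.1 hc)
  nlinarith [Real.exp_pos (lambertW n)]

theorem abs_meanBlocks_sub_le {n : ℕ} (h : IsSaddle n (lambertW n) (Real.exp (lambertW n))) :
    |meanBlocks n - mu n| ≤ 10 ^ 22 * lambertW n := by
  obtain ⟨b₁, -⟩ := h.abs_moments_le
  have hW := h.large
  have hmu : mu n = Real.exp (lambertW n) := by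
    rw [mu, div_eq_iff (by linarith)]
    exact h.mul_eq.trans (mul_comm _ _)
  rw [meanBlocks_eq, hmu, dobinskiMean_natCast n (Real.exp (lambertW n))]
  have := abs_le.1 b₁
  rw [abs_le]
  constructor <;> linarith

theorem abs_varBlocks_sub_le {n : ℕ} (h : IsSaddle n (lambertW n) (Real.exp (lambertW n))) :
    |varBlocks n - sigmaSq n| ≤ 10 ^ 41 * lambertW n ^ 2 := by
  obtain ⟨b₁, b₂⟩ := h.abs_moments_le
  have hW := h.large
  have hsig : sigmaSq n = Real.exp (lambertW n) / (lambertW n + 1) := by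
    rw [sigmaSq, div_eq_div_iff (mul_pos (by linarith) (by linarith)).ne' (by linarith)]
    linear_combination (lambertW n + 1) * h.mul_eq
  rw [varBlocks_eq, hsig, dobinskiMean_natCast n (Real.exp (lambertW n)),
    dobinskiMean_natCast_sq n (Real.exp (lambertW n))]
  set e₁ := dobinskiMean n (fun k => ((k : ℝ) - Real.exp (lambertW n)) ^ 1)
  -- The variance equals `e₂ - e₁² - 1`, so `e₁²`, of order `W²`, dictates the constant `10 ^ 41`.
  have h1 : e₁ ^ 2 ≤ (10 ^ 20 * lambertW n) ^ 2 := sq_le_sq' (abs_le.1 b₁).1 (abs_le.1 b₁).2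
  have h2 := sq_nonneg e₁
  have h3 := abs_le.1 b₂
  have h4 : 1 ≤ lambertW n ^ 2 := one_le_pow₀ (by linarith)
  rw [abs_le]
  constructor <;> nlinarith

end StirlingPartition

theorem mainTheorem3 :
    ((fun n : ℕ => StirlingPartition.meanBlocks n - StirlingPartition.mu n)
        =O[atTop] fun n : ℕ => StirlingPartition.lambertW (n : ℝ)) ∧
    ((fun n : ℕ => StirlingPartition.varBlocks n - StirlingPartition.sigmaSq n)
        =O[atTop] fun n : ℕ => StirlingPartition.lambertW (n : ℝ) ^ 2) := by
  constructor
  · refine IsBigO.of_bound (10 ^ 22) ?_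
    filter_upwards [StirlingPartition.eventually_isSaddle] with n h
    rw [Real.norm_eq_abs, Real.norm_of_nonneg (by linarith [h.large])]
    exact StirlingPartition.abs_meanBlocks_sub_le h
  · refine IsBigO.of_bound (10 ^ 41) ?_
    filter_upwards [StirlingPartition.eventually_isSaddle] with n h
    rw [Real.norm_eq_abs, Real.norm_of_nonneg (sq_nonneg _)]
    exact StirlingPartition.abs_varBlocks_sub_le h
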